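/- For $a\in(0,1/2]$ and $r\in(0,1)$ put $r'=\sqrt{1-r^2}$, $\mathcal K_a(r)=\frac{\pi}{2}\,{}_2F_1(a,1-a;1;r^2)$ with ${}_2F_1$ the Gaussian hypergeometric function, $$\mu_a(r)=\frac{\pi}{2\sin(\pi a)}\frac{\mathcal K_a(r')}{\mathcal K_a(r)},\qquad m_a(r)=\frac{2}{\pi\sin(\pi a)}\,r'^2\,\mathcal K_a(r')\,\mathcal K_a(r),$$ and for $K>0$ let $\varphi_K^a(r)=\mu_a^{-1}(\mu_a(r)/K)$, where $\mu_a^{-1}$ is the inverse of the strictly decreasing bijection $\mu_a:(0,1)\to(0,\infty)$. Let $\lambda(a,r,t)$ and $\tau(a,r,t)$ be real functions on $(0,1/2]\times(0,1)\times(0,1)$. For arbitrarily given $(a,r,t)\in(0,1/2]\times(0,1)\times(0,1)$ define, for $K\in(0,\infty)$, $$g_1(K)=\frac{\varphi_K^a(r)\,\varphi_K^a(t)\,\bigl(e^{\lambda(a,r,t)}\bigr)^{1/K}}{\varphi_K^a(rt)},\qquad g_2(K)=\frac{\varphi_{1/K}^a(r)\,\varphi_{1/K}^a(t)\,\bigl(e^{\tau(a,r,t)}\bigr)^{K}}{\varphi_{1/K}^a(rt)}.$$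 Then: (1) $g_1$ is strictly increasing on $(0,1]$ if and only if $\lambda(a,r,t)\le m_a(r)+m_a(t)-m_a(rt)$; $g_1$ is strictly decreasing on $(0,1]$ if and only if $\lambda(a,r,t)\ge \mu_a(r)+\mu_a(t)-\mu_a(rt)$; and $g_1$ is strictly decreasing on $(1,\infty)$ if and only if $\lambda(a,r,t)\ge m_a(r)+m_a(t)-m_a(rt)$. (2) $g_2$ is strictly increasing on $(0,1]$ if and only if $\tau(a,r,t)\ge m_a(r)+m_a(t)-m_a(rt)$; $g_2$ is strictly increasing on $(1,\infty)$ if and only if $\tau(a,r,t)\ge \mu_a(r)+\mu_a(t)-\mu_a(rt)$; and $g_2$ is strictly decreasing on $(1,\infty)$ if and only if $\tau(a,r,t)\le m_a(r)+m_a(t)-m_a(rt)$. -/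

import Mathlib

noncomputable section

/-- The generalized elliptic integral of the first kind,
`K_a(r) = (π / 2) F(a, 1 - a; 1; r²)`, with `F` Gauss's hypergeometric function. -/
def genEllipticK (a r : ℝ) : ℝ :=
  Real.pi / 2 * ordinaryHypergeometric a (1 - a) (1 : ℝ) (r ^ 2)

/-- The complementary modulus `r' = √(1 - r²)`. -/
def complMod (r : ℝ) : ℝ := Real.sqrt (1 - r ^ 2)

/-- The generalized Grötzsch ring function
`μ_a(r) = π / (2 sin (π a)) * K_a(r') / K_a(r)`. -/
def genMu (a r : ℝ) : ℝ :=
  Real.pi / (2 * Real.sin (Real.pi * a)) * (genEllipticK a (complMod r) / genEllipticK a r)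

/-- The function `m_a(r) = 2 / (π sin (π a)) * r'² K_a(r') K_a(r)`. -/
def genM (a r : ℝ) : ℝ :=
  2 / (Real.pi * Real.sin (Real.pi * a)) *
    (complMod r ^ 2 * genEllipticK a (complMod r) * genEllipticK a r)

/-- The generalized Hersch-Pfluger distortion function `φ_K^a(r) = μ_a⁻¹(μ_a(r) / K)`, where `μ_a⁻¹`
is the inverse of `μ_a` as a map from `(0, 1)` onto `(0, ∞)`. -/
def genPhi (a K r : ℝ) : ℝ :=
  Function.invFunOn (genMu a) (Set.Ioo 0 1) (genMu a r / K)

/-- `K ↦ φ_K^a(r) φ_K^a(t) (e^l)^(1/K) / φ_K^a(rt)`. -/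
def g₁ (l : ℝ) (a r t : ℝ) (K : ℝ) : ℝ :=
  genPhi a K r * genPhi a K t * (Real.exp l) ^ (1 / K) / genPhi a K (r * t)

/-- `K ↦ φ_{1/K}^a(r) φ_{1/K}^a(t) (e^l)^K / φ_{1/K}^a(rt)`. -/
def g₂ (l : ℝ) (a r t : ℝ) (K : ℝ) : ℝ :=
  genPhi a (1 / K) r * genPhi a (1 / K) t * (Real.exp l) ^ K / genPhi a (1 / K) (r * t)

end

/-!
The proof turns each of the six monotonicity statements into a statement about one function of one
variable, and then uses two structural facts about `μ_a` and `m_a`.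

Write `F(z) = F(a, 1 - a; 1; z)` and `w(r) = (1 - r²) F(r²)²`, so that `m_a = μ_a w`. The Legendre
relation (`legendre_relation`, whose constant `sin (π a) / π` comes from Abel's limit theorem and
Euler's limit formula for `Γ`) gives `r μ_a'(r) = -1 / w(r)` (`hasDerivAt_genMu`). With
`x = μ_a(r)` as coordinate and `k = 1 / K`, the logarithmic derivative of `φ_{1/k}(r)` in `k` is
`-x W(k x)`, where `W(x) = w(μ_a⁻¹(x))` is `muWeight`. Hence, as a function of `k`,
`log (φ_{1/k}(r) φ_{1/k}(t) e ^ (l k) / φ_{1/k}(r t))` has derivative `l - H(k)`, with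
`H(k) = A W(k A) + B W(k B) - C W(k C)` (`muWeightDefect`), `A = μ_a(r)`, `B = μ_a(t)`,
`C = μ_a(r t)`. Here `H(1) = m_a(r) + m_a(t) - m_a(r t)`. Everything follows from

* `H(k) < A + B - C` for all `k > 0`, with equality in the limit `k → ∞`;
* `H(k) < H(1)` for `k < 1` and `H(k) > H(1)` for `k > 1`.

(`H` itself need not be monotone.) The first point holds since `W` increases to `1` and `μ_a` is
strictly subadditive: `μ_a(r t) < μ_a(r) + μ_a(t)`, by concavity in `log (1 / r)`. For the second,
`-r d/dr log w(r)` times `μ_a(r)` equals, up to a constant factor,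
`z F(1 - z) · (F(z) - 2 a (1 - a) S(z))` at `z = r²`, where `S(z) = ∑ cₙ zⁿ / (n + 1)` for
`F(z) = ∑ cₙ zⁿ`; both factors increase, the second because its Taylor coefficients are nonnegative
(`genMu_mul_genWeightLogDeriv_strictMonoOn`). This has two consequences: `m_a` is strictly
subadditive as well (`genM_mul_lt`), and `W(k x) / W(x)` is monotone in `x` (`muWeight_mul_le`). So
`x W(k x) - x W(x)` is `m_a` times a factor of constant sign whose absolute value is smallest at
`r t`, and subadditivity of `m_a` passes to it.
-/

open Filter Topology Set

/-! ### Power series with bounded coefficients -/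

/-- A power series with coefficients bounded by `1` converges absolutely in the unit disc. -/
lemma summable_powerSeries_of_abs_le_one {b : ℕ → ℝ} (hb : ∀ n, |b n| ≤ 1) {z : ℝ}
    (hz : |z| < 1) : Summable fun n => b n * z ^ n := by
  refine Summable.of_norm_bounded (summable_geometric_of_lt_one (abs_nonneg z) hz) fun n => ?_
  rw [Real.norm_eq_abs, abs_mul, abs_pow]
  exact mul_le_of_le_one_left (by positivity) (hb n)

lemma summable_derivSeries_of_abs_le_one {b : ℕ → ℝ} (hb : ∀ n, |b n| ≤ 1) {z : ℝ}
    (hz : |z| < 1) : Summable fun n : ℕ => ((n + 1 : ℝ) * b (n + 1)) * z ^ n := by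
  have h1 : Summable fun n : ℕ => ((n : ℝ) ^ 1 * |z| ^ n) :=
    summable_pow_mul_geometric_of_norm_lt_one 1 (by simpa using hz)
  have h2 : Summable fun n : ℕ => (|z| ^ n) := summable_geometric_of_lt_one (abs_nonneg z) hz
  refine Summable.of_norm_bounded (h1.add h2) fun n => ?_
  rw [Real.norm_eq_abs, abs_mul, abs_mul, abs_pow, abs_of_pos (by positivity : (0 : ℝ) < n + 1)]
  have : (n + 1 : ℝ) * |b (n + 1)| ≤ n + 1 := mul_le_of_le_one_right (by positivity) (hb _)
  nlinarith [pow_nonneg (abs_nonneg z) n]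

lemma hasDerivAt_powerSeries_of_abs_le_one {b : ℕ → ℝ} (hb : ∀ n, |b n| ≤ 1) {z : ℝ}
    (hz : |z| < 1) :
    HasDerivAt (fun x => ∑' n, b n * x ^ n) (∑' n : ℕ, ((n + 1 : ℝ) * b (n + 1)) * z ^ n) z := by
  obtain ⟨ρ, hzρ, hρ⟩ := exists_between hz
  have hρ0 : 0 < ρ := (abs_nonneg z).trans_lt hzρ
  have hu : Summable fun n : ℕ => (n : ℝ) * ρ ^ (n - 1) := by
    rw [← summable_nat_add_iff 1]
    have := summable_derivSeries_of_abs_le_one (b := fun _ => 1) (by simp) (z := ρ)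
      (by rwa [abs_of_pos hρ0])
    simpa using this
  have key : HasDerivAt (fun x => ∑' n, b n * x ^ n) (∑' n : ℕ, b n * (n * z ^ (n - 1))) z := by
    refine hasDerivAt_tsum_of_isPreconnected (t := Metric.ball 0 ρ) hu Metric.isOpen_ball
      (convex_ball _ _).isPreconnected (fun n y _ => (hasDerivAt_pow n y).const_mul (b n))
      (fun n y hy => ?_) (y₀ := 0) (by simpa using hρ0)
      (summable_powerSeries_of_abs_le_one hb (by simp)) (by simpa using hzρ)
    have hy' : |y| ≤ ρ := by simpa using (Metric.mem_ball.1 hy).le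
    rw [Real.norm_eq_abs, abs_mul, abs_mul, abs_pow, Nat.abs_cast]
    refine (mul_le_of_le_one_left (by positivity) (hb n)).trans ?_
    gcongr
  convert key using 1
  have hs : Summable fun n : ℕ => b n * (n * z ^ (n - 1)) := by
    rw [← summable_nat_add_iff 1]
    refine (summable_derivSeries_of_abs_le_one hb hz).congr fun n => ?_
    rw [Nat.add_sub_cancel]; push_cast; ring
  rw [hs.tsum_eq_zero_add]
  simp only [CharP.cast_eq_zero, zero_mul, mul_zero, zero_add]
  refine tsum_congr fun n => ?_
  rw [Nat.add_sub_cancel]; push_cast; ring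

lemma powerSeries_monotoneOn {b : ℕ → ℝ} (hb0 : ∀ n, 0 ≤ b n) (hb : ∀ n, b n ≤ 1) :
    MonotoneOn (fun x => ∑' n, b n * x ^ n) (Ico 0 1) := by
  have hb' : ∀ n, |b n| ≤ 1 := fun n => by rw [abs_of_nonneg (hb0 n)]; exact hb n
  intro x hx y hy hxy
  refine Summable.tsum_le_tsum (fun n => ?_)
    (summable_powerSeries_of_abs_le_one hb' (by rw [abs_of_nonneg hx.1]; exact hx.2))
    (summable_powerSeries_of_abs_le_one hb' (by rw [abs_of_nonneg hy.1]; exact hy.2))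
  exact mul_le_mul_of_nonneg_left (pow_le_pow_left₀ hx.1 hxy n) (hb0 n)

lemma powerSeries_zero (b : ℕ → ℝ) : ∑' n, b n * (0 : ℝ) ^ n = b 0 := by
  rw [tsum_eq_single 0 (fun n hn => by simp [hn])]; simp

/-! ### The hypergeometric coefficients -/

/-- The `n`-th Taylor coefficient `(a)ₙ (1 - a)ₙ / (n!)²` of `F(a, 1 - a; 1; z)`. -/
noncomputable def hypCoeff (a : ℝ) (n : ℕ) : ℝ :=
  (ascPochhammer ℝ n).eval a * (ascPochhammer ℝ n).eval (1 - a) / (n.factorial : ℝ) ^ 2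

lemma hypCoeff_zero (a : ℝ) : hypCoeff a 0 = 1 := by simp [hypCoeff]

lemma hypCoeff_succ (a : ℝ) (n : ℕ) :
    hypCoeff a (n + 1) * (n + 1) ^ 2 = hypCoeff a n * ((a + n) * (1 - a + n)) := by
  have : (n.factorial : ℝ) ≠ 0 := by positivity
  simp only [hypCoeff, ascPochhammer_succ_eval, Nat.factorial_succ]
  push_cast
  field_simp

lemma hypCoeff_pos {a : ℝ} (ha : a ∈ Ioc (0 : ℝ) (1 / 2)) (n : ℕ) : 0 < hypCoeff a n := by
  have h1 := ascPochhammer_pos n a ha.1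
  have h2 := ascPochhammer_pos n (1 - a) (by linarith [ha.2])
  unfold hypCoeff; positivity

lemma hypCoeff_le_one {a : ℝ} (ha : a ∈ Ioc (0 : ℝ) (1 / 2)) (n : ℕ) : hypCoeff a n ≤ 1 := by
  induction n with
  | zero => simp [hypCoeff_zero]
  | succ n ih =>
    have h := hypCoeff_succ a n
    have h0 := hypCoeff_pos ha n
    have hn : (0 : ℝ) ≤ n := n.cast_nonneg
    have h1 : (a + n) * (1 - a + n) ≤ (n + 1 : ℝ) ^ 2 := by nlinarith [ha.1, ha.2]
    have h2 : hypCoeff a (n + 1) * (n + 1 : ℝ) ^ 2 ≤ 1 * (n + 1 : ℝ) ^ 2 := by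
      rw [h]
      have : 0 ≤ (a + n) * (1 - a + n) := by
        apply mul_nonneg <;> linarith [ha.1, ha.2]
      nlinarith
    exact le_of_mul_le_mul_right h2 (by positivity)

lemma abs_hypCoeff_le_one {a : ℝ} (ha : a ∈ Ioc (0 : ℝ) (1 / 2)) (n : ℕ) :
    |hypCoeff a n| ≤ 1 := by
  rw [abs_of_pos (hypCoeff_pos ha n)]; exact hypCoeff_le_one ha n

/-- The coefficients telescope: `n cₙ` is a partial sum of the series `∑ a (1 - a) cₖ / (k + 1)`. -/
lemma sum_hypCoeff_div (a : ℝ) (n : ℕ) :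
    ∑ k ∈ Finset.range n, a * (1 - a) * (hypCoeff a k / (k + 1)) = n * hypCoeff a n := by
  induction n with
  | zero => simp
  | succ n ih =>
    rw [Finset.sum_range_succ, ih]
    have h := hypCoeff_succ a n
    have hn : (n + 1 : ℝ) ≠ 0 := by positivity
    push_cast
    field_simp
    linear_combination -h

/-- Euler's limit formula for `Γ` and the reflection formula give `n cₙ → sin (π a) / π`. -/
lemma tendsto_natCast_mul_hypCoeff {a : ℝ} (ha : a ∈ Ioc (0 : ℝ) (1 / 2)) :
    Tendsto (fun n : ℕ => n * hypCoeff a n) atTop (𝓝 (Real.sin (Real.pi * a) / Real.pi)) := by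
  have hsin : 0 < Real.sin (Real.pi * a) := by
    apply Real.sin_pos_of_pos_of_lt_pi
    · exact mul_pos Real.pi_pos ha.1
    · nlinarith [Real.pi_pos, ha.2]
  have hG := (Real.GammaSeq_tendsto_Gamma a).mul (Real.GammaSeq_tendsto_Gamma (1 - a))
  rw [Real.Gamma_mul_Gamma_one_sub] at hG
  have hr : ∀ s : ℝ, Tendsto (fun n : ℕ => (n : ℝ) / (s + n)) atTop (𝓝 1) := fun s => by
    simpa [add_comm] using tendsto_natCast_div_add_atTop s
  have h := ((hr a).mul (hr (1 - a))).div hG (by positivity)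
  rw [one_mul, one_div_div] at h
  refine h.congr' ?_
  filter_upwards [eventually_gt_atTop 0] with n hn
  have hn' : (0 : ℝ) < n := by exact_mod_cast hn
  have hp : ∀ s : ℝ, ∏ j ∈ Finset.range (n + 1), (s + j) =
      (ascPochhammer ℝ n).eval s * (s + n) := fun s => by
    rw [← ascPochhammer_succ_eval]
    induction n + 1 with
    | zero => simp
    | succ k ih => rw [Finset.prod_range_succ, ih, ascPochhammer_succ_eval]
  have h1 := ascPochhammer_pos n a ha.1
  have h2 := ascPochhammer_pos n (1 - a) (by linarith [ha.2])
  have h3 : 0 < a + n := by linarith [ha.1]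
  have h4 : 0 < 1 - a + n := by linarith [ha.2]
  have h5 : (n : ℝ) ^ a * (n : ℝ) ^ (1 - a) = n := by
    rw [← Real.rpow_add hn']; simp
  have h6 : (n : ℝ) ^ (1 - a) = n / (n : ℝ) ^ a := by
    rw [eq_div_iff (by positivity), mul_comm, h5]
  simp only [Pi.div_apply, Real.GammaSeq, hp, hypCoeff, h6]
  field_simp

/-! ### The hypergeometric function and its first-order system -/

/-- The function `F(z) = F(a, 1 - a; 1; z)`, written as a power series. -/
noncomputable def hypF (a z : ℝ) : ℝ := ∑' n, hypCoeff a n * z ^ n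

/-- The companion `S(z) = ∑ cₙ zⁿ / (n + 1)`, where `F(z) = ∑ cₙ zⁿ`.  The hypergeometric equation
for `F` is the system `(1 - z) F' = a (1 - a) S`, `(z S)' = F`. -/
noncomputable def hypS (a z : ℝ) : ℝ := ∑' n : ℕ, hypCoeff a n / (n + 1) * z ^ n

lemma ordinaryHypergeometric_eq_hypF (a z : ℝ) :
    ordinaryHypergeometric a (1 - a) (1 : ℝ) z = hypF a z := by
  rw [ordinaryHypergeometric_eq_tsum, hypF]
  refine tsum_congr fun n => ?_
  simp only [hypCoeff, ascPochhammer_eval_one, smul_eq_mul]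
  ring

section

variable {a : ℝ}

lemma abs_hypCoeff_div_le_one (ha : a ∈ Ioc (0 : ℝ) (1 / 2)) (n : ℕ) :
    |hypCoeff a n / (n + 1)| ≤ 1 := by
  rw [abs_div, abs_of_pos (by positivity : (0 : ℝ) < n + 1), div_le_one (by positivity)]
  linarith [abs_hypCoeff_le_one ha n, (n.cast_nonneg : (0 : ℝ) ≤ n)]

lemma mul_one_sub_bounds (ha : a ∈ Ioc (0 : ℝ) (1 / 2)) :
    0 < a * (1 - a) ∧ a * (1 - a) ≤ 1 / 4 :=
  ⟨mul_pos ha.1 (by linarith [ha.2]), by nlinarith [sq_nonneg (a - 1 / 2)]⟩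

lemma hypF_zero (a : ℝ) : hypF a 0 = 1 := by rw [hypF, powerSeries_zero, hypCoeff_zero]

lemma hypS_zero (a : ℝ) : hypS a 0 = 1 := by
  rw [hypS, powerSeries_zero (fun n : ℕ => hypCoeff a n / (n + 1)), hypCoeff_zero]; simp

lemma hypF_monotoneOn (ha : a ∈ Ioc (0 : ℝ) (1 / 2)) : MonotoneOn (hypF a) (Ico 0 1) :=
  powerSeries_monotoneOn (fun n => (hypCoeff_pos ha n).le) (hypCoeff_le_one ha)

lemma hypS_monotoneOn (ha : a ∈ Ioc (0 : ℝ) (1 / 2)) : MonotoneOn (hypS a) (Ico 0 1) :=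
  powerSeries_monotoneOn (b := fun n : ℕ => hypCoeff a n / (n + 1))
    (fun n => div_nonneg (hypCoeff_pos ha n).le (by positivity))
    (fun n => (le_abs_self _).trans (abs_hypCoeff_div_le_one ha n))

lemma one_le_hypF (ha : a ∈ Ioc (0 : ℝ) (1 / 2)) {z : ℝ} (hz : z ∈ Ico (0 : ℝ) 1) :
    1 ≤ hypF a z := by
  rw [← hypF_zero a]; exact hypF_monotoneOn ha (by simp) hz hz.1

lemma hypF_pos (ha : a ∈ Ioc (0 : ℝ) (1 / 2)) {z : ℝ} (hz : z ∈ Ico (0 : ℝ) 1) :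
    0 < hypF a z := one_pos.trans_le (one_le_hypF ha hz)

lemma one_le_hypS (ha : a ∈ Ioc (0 : ℝ) (1 / 2)) {z : ℝ} (hz : z ∈ Ico (0 : ℝ) 1) :
    1 ≤ hypS a z := by
  rw [← hypS_zero a]; exact hypS_monotoneOn ha (by simp) hz hz.1

/-- `F - 2 a (1 - a) S` has nonnegative Taylor coefficients. -/
lemma hypF_sub_two_mul_hypS_monotoneOn (ha : a ∈ Ioc (0 : ℝ) (1 / 2)) :
    MonotoneOn (fun z => hypF a z - 2 * (a * (1 - a)) * hypS a z) (Ico 0 1) := by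
  have hα := mul_one_sub_bounds ha
  have key : ∀ n : ℕ, 0 ≤ 2 * (a * (1 - a)) / (n + 1 : ℝ) ∧
      2 * (a * (1 - a)) / (n + 1 : ℝ) ≤ 1 := fun n => by
    have hn : (0 : ℝ) ≤ n := n.cast_nonneg
    refine ⟨by have := hα.1; positivity, ?_⟩
    rw [div_le_one (by positivity)]
    linarith [hα.2]
  have h := powerSeries_monotoneOn
    (b := fun n : ℕ => hypCoeff a n * (1 - 2 * (a * (1 - a)) / (n + 1)))
    (fun n => mul_nonneg (hypCoeff_pos ha n).le (by linarith [(key n).2]))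
    (fun n => mul_le_one₀ (hypCoeff_le_one ha n) (by linarith [(key n).2])
      (by linarith [(key n).1]))
  refine h.congr fun z hz => ?_
  have hz' : |z| < 1 := by rw [abs_of_nonneg hz.1]; exact hz.2
  simp only [hypF, hypS]
  rw [← tsum_mul_left, ← Summable.tsum_sub
    (summable_powerSeries_of_abs_le_one (abs_hypCoeff_le_one ha) hz')
    ((summable_powerSeries_of_abs_le_one (abs_hypCoeff_div_le_one ha) hz').mul_left _)]
  refine tsum_congr fun n => ?_
  ring

lemma half_le_hypF_sub_two_mul_hypS (ha : a ∈ Ioc (0 : ℝ) (1 / 2)) {z : ℝ}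
    (hz : z ∈ Ico (0 : ℝ) 1) : 1 / 2 ≤ hypF a z - 2 * (a * (1 - a)) * hypS a z := by
  have h := hypF_sub_two_mul_hypS_monotoneOn ha (by simp : (0 : ℝ) ∈ Ico (0 : ℝ) 1) hz hz.1
  simp only [hypF_zero, hypS_zero] at h
  linarith [(mul_one_sub_bounds ha).2]

lemma hasDerivAt_hypF (ha : a ∈ Ioc (0 : ℝ) (1 / 2)) {z : ℝ} (hz : z ∈ Ico (0 : ℝ) 1) :
    HasDerivAt (hypF a) (a * (1 - a) * hypS a z / (1 - z)) z := by
  have hz' : |z| < 1 := by rw [abs_of_nonneg hz.1]; exact hz.2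
  have h := hasDerivAt_powerSeries_of_abs_le_one (abs_hypCoeff_le_one ha) hz'
  have hs := summable_derivSeries_of_abs_le_one (abs_hypCoeff_le_one ha) hz'
  refine h.congr_deriv ?_
  rw [eq_div_iff (by linarith [hz.2])]
  -- Multiplying by `1 - z` takes differences of consecutive coefficients.
  set D := ∑' n : ℕ, ((n + 1 : ℝ) * hypCoeff a (n + 1)) * z ^ n with hD
  have hs0 : Summable fun n : ℕ => (n * hypCoeff a n) * z ^ n := by
    rw [← summable_nat_add_iff 1]
    refine (hs.mul_left z).congr fun n => ?_
    push_cast; ring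
  have h1 : z * D = ∑' n : ℕ, (n * hypCoeff a n) * z ^ n := by
    rw [hs0.tsum_eq_zero_add, hD, ← tsum_mul_left]
    simp only [CharP.cast_eq_zero, zero_mul, zero_add]
    refine tsum_congr fun n => ?_
    push_cast; ring
  have h2 : D * (1 - z) = D - z * D := by ring
  rw [h2, h1, hD, ← Summable.tsum_sub hs hs0, hypS, ← tsum_mul_left]
  refine tsum_congr fun n => ?_
  have h3 := hypCoeff_succ a n
  have hn : (n + 1 : ℝ) ≠ 0 := by positivity
  field_simp
  linear_combination z ^ n * h3

lemma hasDerivAt_mul_hypS (ha : a ∈ Ioc (0 : ℝ) (1 / 2)) {z : ℝ} (hz : z ∈ Ico (0 : ℝ) 1) :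
    HasDerivAt (fun x => x * hypS a x) (hypF a z) z := by
  have hz' : |z| < 1 := by rw [abs_of_nonneg hz.1]; exact hz.2
  let b : ℕ → ℝ := fun n => if n = 0 then 0 else hypCoeff a (n - 1) / n
  have hb : ∀ n, |b n| ≤ 1 := fun n => by
    cases n with
    | zero => simp [b]
    | succ n => simpa [b] using abs_hypCoeff_div_le_one ha n
  have h := hasDerivAt_powerSeries_of_abs_le_one hb hz'
  have h1 : ∑' n : ℕ, ((n + 1 : ℝ) * b (n + 1)) * z ^ n = hypF a z := by
    refine tsum_congr fun n => ?_
    have hn : (n + 1 : ℝ) ≠ 0 := by positivity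
    have hbn : b (n + 1) = hypCoeff a n / (n + 1) := by simp [b]
    rw [hbn]; field_simp
  rw [h1] at h
  refine h.congr_of_eventuallyEq ?_
  have : ∀ᶠ x : ℝ in 𝓝 z, |x| < 1 := (isOpen_lt continuous_abs continuous_const).mem_nhds hz'
  filter_upwards [this] with x hx
  rw [(summable_powerSeries_of_abs_le_one hb hx).tsum_eq_zero_add, hypS, ← tsum_mul_left]
  simp only [b, if_true, zero_mul, zero_add]
  refine tsum_congr fun n => ?_
  simp; ring

/-- Abel's limit theorem identifies the boundary value of `S` at `1`. -/
lemma tendsto_hypS_one (ha : a ∈ Ioc (0 : ℝ) (1 / 2)) :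
    Tendsto (fun z => a * (1 - a) * hypS a z) (𝓝[<] 1)
      (𝓝 (Real.sin (Real.pi * a) / Real.pi)) := by
  have h := Real.tendsto_tsum_powerSeries_nhdsWithin_lt
    ((tendsto_natCast_mul_hypCoeff ha).congr fun n => (sum_hypCoeff_div a n).symm)
  refine h.congr fun z => ?_
  rw [hypS, ← tsum_mul_left]
  exact tsum_congr fun n => by ring

/-! ### The weight `(1 - z) F(z)²` and the Legendre relation -/

lemma hasDerivAt_one_sub_mul_hypF_sq (ha : a ∈ Ioc (0 : ℝ) (1 / 2)) {z : ℝ}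
    (hz : z ∈ Ico (0 : ℝ) 1) :
    HasDerivAt (fun x => (1 - x) * hypF a x ^ 2)
      (-(hypF a z * (hypF a z - 2 * (a * (1 - a)) * hypS a z))) z := by
  have h := ((hasDerivAt_id z).const_sub 1).mul ((hasDerivAt_hypF ha hz).pow 2)
  refine h.congr_deriv ?_
  have : 1 - z ≠ 0 := by linarith [hz.2]
  simp only [id, Pi.pow_apply]
  push_cast
  field_simp
  ring

lemma one_sub_mul_hypF_sq_strictAntiOn (ha : a ∈ Ioc (0 : ℝ) (1 / 2)) :
    StrictAntiOn (fun x => (1 - x) * hypF a x ^ 2) (Ico 0 1) := by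
  refine strictAntiOn_of_deriv_neg (convex_Ico 0 1) (fun z hz =>
    (hasDerivAt_one_sub_mul_hypF_sq ha hz).continuousAt.continuousWithinAt) fun z hz => ?_
  rw [interior_Ico] at hz
  have hz' : z ∈ Ico (0 : ℝ) 1 := ⟨hz.1.le, hz.2⟩
  rw [(hasDerivAt_one_sub_mul_hypF_sq ha hz').deriv]
  have h1 := hypF_pos ha hz'
  have h2 := half_le_hypF_sub_two_mul_hypS ha hz'
  have : 0 < hypF a z * (hypF a z - 2 * (a * (1 - a)) * hypS a z) :=
    mul_pos h1 (by linarith)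
  linarith

/-- Since `(1 - z) F(z)² ≤ 1`, the growth of `F` at `1` is at most that of `(1 - z) ^ (-1 / 2)`. -/
lemma tendsto_one_sub_mul_hypF_one (ha : a ∈ Ioc (0 : ℝ) (1 / 2)) :
    Tendsto (fun z => (1 - z) * hypF a z) (𝓝[<] 1) (𝓝 0) := by
  have hsq : Tendsto (fun z : ℝ => Real.sqrt (1 - z)) (𝓝[<] 1) (𝓝 0) := by
    have : Continuous fun z : ℝ => Real.sqrt (1 - z) := by fun_prop
    simpa using (this.tendsto 1).mono_left nhdsWithin_le_nhds
  have hmem : ∀ᶠ z : ℝ in 𝓝[<] 1, z ∈ Ioo (0 : ℝ) 1 := Ioo_mem_nhdsLT one_pos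
  refine squeeze_zero' ?_ ?_ hsq
  · filter_upwards [hmem] with z hz
    exact mul_nonneg (by linarith [hz.2]) (hypF_pos ha ⟨hz.1.le, hz.2⟩).le
  · filter_upwards [hmem] with z hz
    have h := (one_sub_mul_hypF_sq_strictAntiOn ha).antitoneOn
      (by simp : (0 : ℝ) ∈ Ico (0 : ℝ) 1) ⟨hz.1.le, hz.2⟩ hz.1.le
    simp only [hypF_zero, sub_zero, one_pow, mul_one] at h
    apply Real.le_sqrt_of_sq_le
    nlinarith [hz.2]

/-- The Legendre relation, in terms of `F` and `S`. -/
lemma legendre_relation (ha : a ∈ Ioc (0 : ℝ) (1 / 2)) {z : ℝ} (hz : z ∈ Ioo (0 : ℝ) 1) :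
    a * (1 - a) * (z * hypS a z * hypF a (1 - z) + (1 - z) * hypS a (1 - z) * hypF a z) =
      Real.sin (Real.pi * a) / Real.pi := by
  set P : ℝ → ℝ := fun z =>
    a * (1 - a) * (z * hypS a z * hypF a (1 - z) + (1 - z) * hypS a (1 - z) * hypF a z) with hP
  have hd : ∀ x ∈ Ioo (0 : ℝ) 1, HasDerivAt P 0 x := fun x hx => by
    have hx1 : x ∈ Ico (0 : ℝ) 1 := ⟨hx.1.le, hx.2⟩
    have hx2 : 1 - x ∈ Ico (0 : ℝ) 1 := ⟨by linarith [hx.2], by linarith [hx.1]⟩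
    have hsub : HasDerivAt (fun y : ℝ => 1 - y) (-1) x := (hasDerivAt_id x).const_sub 1
    have h1 := (hasDerivAt_mul_hypS ha hx1).mul ((hasDerivAt_hypF ha hx2).comp x hsub)
    have h2 := ((hasDerivAt_mul_hypS ha hx2).comp x hsub).mul (hasDerivAt_hypF ha hx1)
    refine ((h1.add h2).const_mul (a * (1 - a))).congr_deriv ?_
    have h3 : x ≠ 0 := hx.1.ne'
    have h4 : 1 - x ≠ 0 := by linarith [hx.2]
    simp only [Function.comp, sub_sub_cancel]
    field_simp
    ring
  have hconst : ∀ x ∈ Ioo (0 : ℝ) 1, P x = P z := fun x hx =>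
    isOpen_Ioo.is_const_of_deriv_eq_zero isPreconnected_Ioo
      (fun y hy => (hd y hy).differentiableAt.differentiableWithinAt)
      (fun y hy => (hd y hy).deriv) hx hz
  have hid : Tendsto (fun x : ℝ => x) (𝓝[<] 1) (𝓝 1) := tendsto_id.mono_left nhdsWithin_le_nhds
  have hsub : Tendsto (fun x : ℝ => 1 - x) (𝓝[<] 1) (𝓝 0) := by simpa using hid.const_sub 1
  have hF0 : Tendsto (fun x => hypF a (1 - x)) (𝓝[<] 1) (𝓝 1) := by
    have := (hasDerivAt_hypF ha (by simp : (0 : ℝ) ∈ Ico (0 : ℝ) 1)).continuousAt.tendsto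
    rw [hypF_zero] at this
    exact this.comp hsub
  have hS0 : Tendsto (fun x => hypS a (1 - x)) (𝓝[<] 1) (𝓝 1) := by
    have := (hasDerivAt_powerSeries_of_abs_le_one (abs_hypCoeff_div_le_one ha)
      (by simp : |(0 : ℝ)| < 1)).continuousAt.tendsto
    change Tendsto (hypS a) (𝓝 0) (𝓝 (hypS a 0)) at this
    rw [hypS_zero] at this
    exact this.comp hsub
  have hlim : Tendsto P (𝓝[<] 1) (𝓝 (Real.sin (Real.pi * a) / Real.pi)) := by
    have h := ((hid.mul (tendsto_hypS_one ha)).mul hF0).add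
      ((hS0.mul (tendsto_one_sub_mul_hypF_one ha)).const_mul (a * (1 - a)))
    simp only [one_mul, mul_one, mul_zero, add_zero] at h
    refine h.congr fun x => ?_
    simp only [hP]; ring
  have hc : Tendsto P (𝓝[<] 1) (𝓝 (P z)) := by
    refine tendsto_const_nhds.congr' ?_
    filter_upwards [Ioo_mem_nhdsLT (one_pos : (0 : ℝ) < 1)] with x hx
    exact (hconst x hx).symm
  exact tendsto_nhds_unique hc hlim

/-- `w ↦ (1 - w) F(w)` is decreasing; here `z = 1 - w`. -/
lemma mul_hypF_one_sub_strictMonoOn (ha : a ∈ Ioc (0 : ℝ) (1 / 2)) :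
    StrictMonoOn (fun z => z * hypF a (1 - z)) (Ioo 0 1) := by
  have hd : ∀ x ∈ Ioo (0 : ℝ) 1, HasDerivAt (fun z => z * hypF a (1 - z))
      (hypF a (1 - x) - a * (1 - a) * hypS a (1 - x)) x := fun x hx => by
    have hx2 : 1 - x ∈ Ico (0 : ℝ) 1 := ⟨by linarith [hx.2], by linarith [hx.1]⟩
    have hsub : HasDerivAt (fun y : ℝ => 1 - y) (-1) x := (hasDerivAt_id x).const_sub 1
    refine ((hasDerivAt_id x).mul ((hasDerivAt_hypF ha hx2).comp x hsub)).congr_deriv ?_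
    have h3 : x ≠ 0 := hx.1.ne'
    simp only [Function.comp, sub_sub_cancel, id]
    field_simp
    ring
  refine strictMonoOn_of_deriv_pos (convex_Ioo 0 1)
    (fun x hx => (hd x hx).continuousAt.continuousWithinAt) fun x hx => ?_
  rw [interior_Ioo] at hx
  rw [(hd x hx).deriv]
  have hx2 : 1 - x ∈ Ico (0 : ℝ) 1 := ⟨by linarith [hx.2], by linarith [hx.1]⟩
  have h1 := half_le_hypF_sub_two_mul_hypS ha hx2
  have h2 := hypF_pos ha hx2
  linarith

end

/-! ### The functions `μ_a` and `m_a` in terms of the weight -/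

/-- The weight `w(r) = r'² F(r²)²`, that is `(4 / π²) r'² K_a(r)²`. -/
noncomputable def genWeight (a r : ℝ) : ℝ := (1 - r ^ 2) * hypF a (r ^ 2) ^ 2

/-- The function `V(r) = -r w'(r)`, where `w` is the weight `genWeight`. -/
noncomputable def genWeightLogDeriv (a r : ℝ) : ℝ :=
  2 * r ^ 2 * (hypF a (r ^ 2) * (hypF a (r ^ 2) - 2 * (a * (1 - a)) * hypS a (r ^ 2)))

/-- The inverse of `μ_a : (0, 1) → (0, ∞)`. -/
noncomputable def genMuInv (a : ℝ) : ℝ → ℝ := Function.invFunOn (genMu a) (Ioo 0 1)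

lemma genPhi_eq (a K r : ℝ) : genPhi a K r = genMuInv a (genMu a r / K) := rfl

section

variable {a r : ℝ}

lemma sin_pi_mul_pos (ha : a ∈ Ioc (0 : ℝ) (1 / 2)) : 0 < Real.sin (Real.pi * a) := by
  apply Real.sin_pos_of_pos_of_lt_pi
  · exact mul_pos Real.pi_pos ha.1
  · nlinarith [Real.pi_pos, ha.2]

lemma sq_mem_Ioo (hr : r ∈ Ioo (0 : ℝ) 1) : r ^ 2 ∈ Ioo (0 : ℝ) 1 :=
  ⟨pow_pos hr.1 2, pow_lt_one₀ hr.1.le hr.2 two_ne_zero⟩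

lemma one_sub_sq_mem_Ioo (hr : r ∈ Ioo (0 : ℝ) 1) : 1 - r ^ 2 ∈ Ioo (0 : ℝ) 1 :=
  ⟨by linarith [(sq_mem_Ioo hr).2], by linarith [(sq_mem_Ioo hr).1]⟩

lemma complMod_sq (hr : r ∈ Ioo (0 : ℝ) 1) : complMod r ^ 2 = 1 - r ^ 2 :=
  Real.sq_sqrt (one_sub_sq_mem_Ioo hr).1.le

lemma genEllipticK_eq (a r : ℝ) : genEllipticK a r = Real.pi / 2 * hypF a (r ^ 2) := by
  rw [genEllipticK, ordinaryHypergeometric_eq_hypF]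

lemma genMu_eq (hr : r ∈ Ioo (0 : ℝ) 1) : genMu a r =
    Real.pi / (2 * Real.sin (Real.pi * a)) * (hypF a (1 - r ^ 2) / hypF a (r ^ 2)) := by
  rw [genMu, genEllipticK_eq, genEllipticK_eq, complMod_sq hr,
    mul_div_mul_left _ _ (by positivity)]

lemma genM_eq (ha : a ∈ Ioc (0 : ℝ) (1 / 2)) (hr : r ∈ Ioo (0 : ℝ) 1) :
    genM a r = genMu a r * genWeight a r := by
  have h1 := (hypF_pos ha (Ioo_subset_Ico_self (sq_mem_Ioo hr))).ne'
  have h2 := (sin_pi_mul_pos ha).ne'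
  rw [genM, genMu_eq hr, genEllipticK_eq, genEllipticK_eq, complMod_sq hr, genWeight]
  field_simp

lemma genMu_pos (ha : a ∈ Ioc (0 : ℝ) (1 / 2)) (hr : r ∈ Ioo (0 : ℝ) 1) : 0 < genMu a r := by
  rw [genMu_eq hr]
  have h1 := hypF_pos ha (Ioo_subset_Ico_self (sq_mem_Ioo hr))
  have h2 := hypF_pos ha (Ioo_subset_Ico_self (one_sub_sq_mem_Ioo hr))
  have h3 := sin_pi_mul_pos ha
  positivity

lemma genWeight_pos (ha : a ∈ Ioc (0 : ℝ) (1 / 2)) (hr : r ∈ Ioo (0 : ℝ) 1) :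
    0 < genWeight a r := by
  have h1 := hypF_pos ha (Ioo_subset_Ico_self (sq_mem_Ioo hr))
  have h2 := (one_sub_sq_mem_Ioo hr).1
  unfold genWeight; positivity

lemma genWeight_strictAntiOn (ha : a ∈ Ioc (0 : ℝ) (1 / 2)) :
    StrictAntiOn (genWeight a) (Ico 0 1) := by
  intro x hx y hy hxy
  exact one_sub_mul_hypF_sq_strictAntiOn ha
    ⟨sq_nonneg x, pow_lt_one₀ hx.1 hx.2 two_ne_zero⟩
    ⟨sq_nonneg y, pow_lt_one₀ hy.1 hy.2 two_ne_zero⟩ (pow_lt_pow_left₀ hxy hx.1 two_ne_zero)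

lemma genWeight_zero (a : ℝ) : genWeight a 0 = 1 := by simp [genWeight, hypF_zero]

lemma genWeight_lt_one (ha : a ∈ Ioc (0 : ℝ) (1 / 2)) (hr : r ∈ Ioo (0 : ℝ) 1) :
    genWeight a r < 1 := by
  rw [← genWeight_zero a]
  exact genWeight_strictAntiOn ha (by simp) (Ioo_subset_Ico_self hr) hr.1

lemma continuousAt_genWeight_zero (ha : a ∈ Ioc (0 : ℝ) (1 / 2)) :
    ContinuousAt (genWeight a) 0 := by
  have h : ContinuousAt (hypF a) ((0 : ℝ) ^ 2) :=
    (hasDerivAt_hypF ha (by simp : (0 : ℝ) ^ 2 ∈ Ico (0 : ℝ) 1)).continuousAt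
  have h1 : ContinuousAt (fun r : ℝ => hypF a (r ^ 2)) 0 :=
    h.comp (f := fun r : ℝ => r ^ 2) (continuous_pow 2).continuousAt
  have h2 : ContinuousAt (fun r : ℝ => 1 - r ^ 2) 0 := by fun_prop
  exact h2.mul (h1.pow 2)

lemma hasDerivAt_genWeight (ha : a ∈ Ioc (0 : ℝ) (1 / 2)) (hr : r ∈ Ioo (0 : ℝ) 1) :
    HasDerivAt (genWeight a) (-(genWeightLogDeriv a r / r)) r := by
  have h := (hasDerivAt_one_sub_mul_hypF_sq ha (Ioo_subset_Ico_self (sq_mem_Ioo hr))).comp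
    (h := fun x : ℝ => x ^ 2) r (hasDerivAt_pow 2 r)
  refine h.congr_deriv ?_
  have := hr.1.ne'
  unfold genWeightLogDeriv
  field_simp
  ring

/-- The formula `r μ_a'(r) = -1 / w(r)`, a form of the Legendre relation. -/
lemma hasDerivAt_genMu (ha : a ∈ Ioc (0 : ℝ) (1 / 2)) (hr : r ∈ Ioo (0 : ℝ) 1) :
    HasDerivAt (genMu a) (-(1 / genWeight a r / r)) r := by
  have hz := sq_mem_Ioo hr
  have hz' := one_sub_sq_mem_Ioo hr
  have hF := hypF_pos ha (Ioo_subset_Ico_self hz)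
  have h1 := (hasDerivAt_hypF ha (Ioo_subset_Ico_self hz)).comp (h := fun x : ℝ => x ^ 2) r
    (hasDerivAt_pow 2 r)
  have h2 := (hasDerivAt_hypF ha (Ioo_subset_Ico_self hz')).comp (h := fun x : ℝ => 1 - x ^ 2) r
    ((hasDerivAt_pow 2 r).const_sub 1)
  have h := (h2.div h1 hF.ne').const_mul (Real.pi / (2 * Real.sin (Real.pi * a)))
  have hev : genMu a =ᶠ[𝓝 r] fun y => Real.pi / (2 * Real.sin (Real.pi * a)) *
      (((hypF a ∘ fun x => 1 - x ^ 2) / (hypF a ∘ fun x => x ^ 2)) y) := by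
    filter_upwards [Ioo_mem_nhds hr.1 hr.2] with y hy
    exact genMu_eq hy
  refine (h.congr_of_eventuallyEq hev).congr_deriv ?_
  have hL := legendre_relation ha hz
  have hs := (sin_pi_mul_pos ha).ne'
  have hr0 := hr.1.ne'
  have hz0 := hz'.1.ne'
  have hF0 := hF.ne'
  rw [eq_div_iff Real.pi_ne_zero] at hL
  simp only [Function.comp, sub_sub_cancel, genWeight]
  push_cast
  field_simp
  linear_combination -hL

/-- `F(z) ≥ 1 - a (1 - a) log (1 - z)`, so `F` is unbounded near `1`. -/
lemma tendsto_hypF_one (ha : a ∈ Ioc (0 : ℝ) (1 / 2)) :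
    Tendsto (hypF a) (𝓝[<] 1) atTop := by
  have hα := (mul_one_sub_bounds ha).1
  have hd : ∀ x ∈ Ico (0 : ℝ) 1, HasDerivAt
      (fun z => hypF a z + a * (1 - a) * Real.log (1 - z))
      (a * (1 - a) * hypS a x / (1 - x) + a * (1 - a) * (-1 / (1 - x))) x := fun x hx =>
    (hasDerivAt_hypF ha hx).add ((((hasDerivAt_id x).const_sub 1).log
      (by simpa using (sub_pos.2 hx.2).ne')).const_mul _)
  have hm : MonotoneOn (fun z => hypF a z + a * (1 - a) * Real.log (1 - z)) (Ico 0 1) := by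
    refine monotoneOn_of_deriv_nonneg (convex_Ico 0 1)
      (fun x hx => (hd x hx).continuousAt.continuousWithinAt)
      (fun x hx => (hd x (interior_subset hx)).differentiableAt.differentiableWithinAt)
      fun x hx => ?_
    replace hx := interior_subset hx
    rw [(hd x hx).deriv]
    have h1 := one_le_hypS ha hx
    have h2 : 0 < 1 - x := sub_pos.2 hx.2
    have : a * (1 - a) * hypS a x / (1 - x) + a * (1 - a) * (-1 / (1 - x)) =
        a * (1 - a) * (hypS a x - 1) / (1 - x) := by ring
    rw [this]
    exact div_nonneg (mul_nonneg hα.le (by linarith)) h2.le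
  have hlog : Tendsto (fun z : ℝ => Real.log (1 - z)) (𝓝[<] 1) atBot := by
    refine Real.tendsto_log_nhdsGT_zero.comp (tendsto_nhdsWithin_iff.2 ⟨?_, ?_⟩)
    · have : Continuous fun z : ℝ => 1 - z := by fun_prop
      simpa using (this.tendsto 1).mono_left nhdsWithin_le_nhds
    · filter_upwards [self_mem_nhdsWithin] with z hz
      exact sub_pos.2 (mem_Iio.1 hz)
  have h := (tendsto_neg_atBot_atTop.comp hlog).const_mul_atTop hα
  refine tendsto_atTop_mono' _ ?_ h
  filter_upwards [Ioo_mem_nhdsLT (one_pos : (0 : ℝ) < 1)] with z hz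
  have := hm (by simp : (0 : ℝ) ∈ Ico (0 : ℝ) 1) (Ioo_subset_Ico_self hz) hz.1.le
  simp only [hypF_zero, sub_zero, Real.log_one, mul_zero, add_zero] at this
  simp only [Function.comp]
  linarith

lemma tendsto_hypF_zero (ha : a ∈ Ioc (0 : ℝ) (1 / 2)) :
    Tendsto (hypF a) (𝓝 0) (𝓝 1) := by
  have := (hasDerivAt_hypF ha (by simp : (0 : ℝ) ∈ Ico (0 : ℝ) 1)).continuousAt.tendsto
  rwa [hypF_zero] at this

lemma tendsto_sq_one : Tendsto (fun r : ℝ => r ^ 2) (𝓝[<] 1) (𝓝[<] 1) := by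
  refine tendsto_nhdsWithin_iff.2 ⟨?_, ?_⟩
  · simpa using ((continuous_pow 2).tendsto (1 : ℝ)).mono_left nhdsWithin_le_nhds
  · filter_upwards [Ioo_mem_nhdsLT (one_pos : (0 : ℝ) < 1)] with r hr
    exact (sq_mem_Ioo hr).2

lemma tendsto_one_sub_sq_one : Tendsto (fun r : ℝ => 1 - r ^ 2) (𝓝[<] 1) (𝓝 0) := by
  simpa using (tendsto_sq_one.mono_right nhdsWithin_le_nhds).const_sub 1

lemma tendsto_genMu_one (ha : a ∈ Ioc (0 : ℝ) (1 / 2)) :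
    Tendsto (genMu a) (𝓝[<] 1) (𝓝 0) := by
  have h := (((tendsto_hypF_zero ha).comp tendsto_one_sub_sq_one).div_atTop
    ((tendsto_hypF_one ha).comp tendsto_sq_one)).const_mul
      (Real.pi / (2 * Real.sin (Real.pi * a)))
  rw [mul_zero] at h
  refine h.congr' ?_
  filter_upwards [Ioo_mem_nhdsLT (one_pos : (0 : ℝ) < 1)] with r hr
  exact (genMu_eq hr).symm

lemma tendsto_genMu_zero (ha : a ∈ Ioc (0 : ℝ) (1 / 2)) :
    Tendsto (genMu a) (𝓝[>] 0) atTop := by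
  have hs := sin_pi_mul_pos ha
  have hsq : Tendsto (fun r : ℝ => r ^ 2) (𝓝[>] 0) (𝓝 0) := by
    simpa using ((continuous_pow 2).tendsto (0 : ℝ)).mono_left nhdsWithin_le_nhds
  have hsub : Tendsto (fun r : ℝ => 1 - r ^ 2) (𝓝[>] 0) (𝓝[<] 1) := by
    refine tendsto_nhdsWithin_iff.2 ⟨by simpa using hsq.const_sub 1, ?_⟩
    filter_upwards [Ioo_mem_nhdsGT (one_pos : (0 : ℝ) < 1)] with r hr
    exact (one_sub_sq_mem_Ioo hr).2
  have hinv := ((tendsto_hypF_zero ha).comp hsq).inv₀ one_ne_zero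
  rw [inv_one] at hinv
  have h := (((tendsto_hypF_one ha).comp hsub).atTop_mul_pos one_pos hinv).const_mul_atTop
    (by positivity : 0 < Real.pi / (2 * Real.sin (Real.pi * a)))
  refine h.congr' ?_
  filter_upwards [Ioo_mem_nhdsGT (one_pos : (0 : ℝ) < 1)] with r hr
  rw [genMu_eq hr, div_eq_mul_inv (hypF a (1 - r ^ 2))]
  rfl

lemma tendsto_genM_one (ha : a ∈ Ioc (0 : ℝ) (1 / 2)) :
    Tendsto (genM a) (𝓝[<] 1) (𝓝 0) := by
  have h := (((tendsto_hypF_zero ha).comp tendsto_one_sub_sq_one).mul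
    ((tendsto_one_sub_mul_hypF_one ha).comp tendsto_sq_one)).const_mul
      (Real.pi / (2 * Real.sin (Real.pi * a)))
  rw [mul_zero, mul_zero] at h
  refine h.congr' ?_
  filter_upwards [Ioo_mem_nhdsLT (one_pos : (0 : ℝ) < 1)] with r hr
  have h1 := (hypF_pos ha (Ioo_subset_Ico_self (sq_mem_Ioo hr))).ne'
  rw [genM_eq ha hr, genMu_eq hr, genWeight]
  simp only [Function.comp]
  field_simp

/-- The product `μ_a V` is, up to a constant, the product of the increasing functions
`z F(1 - z)` and `F - 2 a (1 - a) S` of `z = r²`. -/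
lemma genMu_mul_genWeightLogDeriv_strictMonoOn (ha : a ∈ Ioc (0 : ℝ) (1 / 2)) :
    StrictMonoOn (fun r => genMu a r * genWeightLogDeriv a r) (Ioo 0 1) := by
  have hs := sin_pi_mul_pos ha
  have key : ∀ r ∈ Ioo (0 : ℝ) 1, genMu a r * genWeightLogDeriv a r =
      Real.pi / Real.sin (Real.pi * a) * (r ^ 2 * hypF a (1 - r ^ 2) *
        (hypF a (r ^ 2) - 2 * (a * (1 - a)) * hypS a (r ^ 2))) := fun r hr => by
    have h1 := (hypF_pos ha (Ioo_subset_Ico_self (sq_mem_Ioo hr))).ne'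
    rw [genMu_eq hr, genWeightLogDeriv]
    field_simp
  intro x hx y hy hxy
  have hxy2 : x ^ 2 < y ^ 2 := pow_lt_pow_left₀ hxy hx.1.le two_ne_zero
  have hx2 := sq_mem_Ioo hx
  have hy2 := sq_mem_Ioo hy
  simp only [key x hx, key y hy]
  refine mul_lt_mul_of_pos_left ?_ (by positivity)
  refine mul_lt_mul (mul_hypF_one_sub_strictMonoOn ha hx2 hy2 hxy2)
    (hypF_sub_two_mul_hypS_monotoneOn ha (Ioo_subset_Ico_self hx2) (Ioo_subset_Ico_self hy2)
      hxy2.le) ?_ ?_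
  · linarith [half_le_hypF_sub_two_mul_hypS ha (Ioo_subset_Ico_self hx2)]
  · exact (mul_pos hy2.1 (hypF_pos ha (Ioo_subset_Ico_self (one_sub_sq_mem_Ioo hy)))).le

lemma hasDerivAt_genM (ha : a ∈ Ioc (0 : ℝ) (1 / 2)) (hr : r ∈ Ioo (0 : ℝ) 1) :
    HasDerivAt (genM a) (-((1 + genMu a r * genWeightLogDeriv a r) / r)) r := by
  have hev : genM a =ᶠ[𝓝 r] fun y => genMu a y * genWeight a y := by
    filter_upwards [Ioo_mem_nhds hr.1 hr.2] with y hy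
    exact genM_eq ha hy
  refine (((hasDerivAt_genMu ha hr).mul (hasDerivAt_genWeight ha hr)).congr_of_eventuallyEq
    hev).congr_deriv ?_
  have h1 := (genWeight_pos ha hr).ne'
  have h2 := hr.1.ne'
  field_simp
  ring

/-! ### Subadditivity in the variable `log (1 / r)` -/

/-- If `-r N'(r)` is strictly increasing, then `N` is strictly concave as a function of
`log (1 / r)`; if moreover `N` vanishes at `r = 1`, it is strictly subadditive. -/
lemma lt_add_of_strictMonoOn_of_tendsto {N ρ : ℝ → ℝ}
    (hN : ∀ r ∈ Ioo (0 : ℝ) 1, HasDerivAt N (-(ρ r / r)) r) (hρ : StrictMonoOn ρ (Ioo 0 1))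
    (h1 : Tendsto N (𝓝[<] 1) (𝓝 0)) {r t : ℝ} (hr : r ∈ Ioo (0 : ℝ) 1)
    (ht : t ∈ Ioo (0 : ℝ) 1) : N (r * t) < N r + N t := by
  have hmem : ∀ x ∈ Ioo (0 : ℝ) 1, r * x ∈ Ioo (0 : ℝ) 1 := fun x hx =>
    ⟨mul_pos hr.1 hx.1, mul_lt_one_of_nonneg_of_lt_one_left hr.1.le hr.2 hx.2.le⟩
  set D : ℝ → ℝ := fun x => N r + N x - N (r * x) with hD
  have hd : ∀ x ∈ Ioo (0 : ℝ) 1, HasDerivAt D ((ρ (r * x) - ρ x) / x) x := fun x hx => by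
    have hm : HasDerivAt (fun y => r * y) r x := by
      simpa using (hasDerivAt_id x).const_mul r
    refine (((hN x hx).const_add (N r)).sub ((hN _ (hmem x hx)).comp x hm)).congr_deriv ?_
    have h2 := hx.1.ne'
    have h3 := hr.1.ne'
    field_simp
    ring
  have hanti : StrictAntiOn D (Ioo 0 1) := by
    refine strictAntiOn_of_deriv_neg (convex_Ioo 0 1)
      (fun x hx => (hd x hx).continuousAt.continuousWithinAt) fun x hx => ?_
    rw [interior_Ioo] at hx
    rw [(hd x hx).deriv]
    exact div_neg_of_neg_of_pos
      (sub_neg.2 (hρ (hmem x hx) hx (mul_lt_of_lt_one_left hx.1 hr.2))) hx.1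
  have hlim : Tendsto D (𝓝[<] 1) (𝓝 0) := by
    have hc : Tendsto (fun x => N (r * x)) (𝓝[<] 1) (𝓝 (N r)) := by
      refine (hN r hr).continuousAt.tendsto.comp ?_
      have : Continuous fun x : ℝ => r * x := by fun_prop
      simpa using (this.tendsto 1).mono_left nhdsWithin_le_nhds
    simpa [hD] using (h1.const_add (N r)).sub hc
  obtain ⟨u, htu, hu1⟩ := exists_between ht.2
  have hu : u ∈ Ioo (0 : ℝ) 1 := ⟨ht.1.trans htu, hu1⟩
  have h0 : 0 ≤ D u := by
    refine le_of_tendsto hlim ?_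
    filter_upwards [Ioo_mem_nhdsLT hu1] with x hx
    exact (hanti hu ⟨hu.1.trans hx.1, hx.2⟩ hx.1).le
  have := hanti ht hu htu
  simp only [hD] at this h0
  linarith

lemma genMu_mul_lt (ha : a ∈ Ioc (0 : ℝ) (1 / 2)) {r t : ℝ} (hr : r ∈ Ioo (0 : ℝ) 1)
    (ht : t ∈ Ioo (0 : ℝ) 1) : genMu a (r * t) < genMu a r + genMu a t := by
  refine lt_add_of_strictMonoOn_of_tendsto (ρ := fun r => 1 / genWeight a r)
    (fun r hr => hasDerivAt_genMu ha hr) ?_ (tendsto_genMu_one ha) hr ht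
  intro x hx y hy hxy
  exact one_div_lt_one_div_of_lt (genWeight_pos ha hy)
    (genWeight_strictAntiOn ha (Ioo_subset_Ico_self hx) (Ioo_subset_Ico_self hy) hxy)

lemma genM_mul_lt (ha : a ∈ Ioc (0 : ℝ) (1 / 2)) {r t : ℝ} (hr : r ∈ Ioo (0 : ℝ) 1)
    (ht : t ∈ Ioo (0 : ℝ) 1) : genM a (r * t) < genM a r + genM a t :=
  lt_add_of_strictMonoOn_of_tendsto (fun r hr => hasDerivAt_genM ha hr)
    (fun _ hx _ hy hxy => by
      simpa using genMu_mul_genWeightLogDeriv_strictMonoOn ha hx hy hxy)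
    (tendsto_genM_one ha) hr ht

end

/-! ### The inverse of `μ_a` -/

section

variable {a : ℝ}

lemma genMu_strictAntiOn (ha : a ∈ Ioc (0 : ℝ) (1 / 2)) : StrictAntiOn (genMu a) (Ioo 0 1) := by
  refine strictAntiOn_of_deriv_neg (convex_Ioo 0 1)
    (fun x hx => (hasDerivAt_genMu ha hx).continuousAt.continuousWithinAt) fun x hx => ?_
  rw [interior_Ioo] at hx
  rw [(hasDerivAt_genMu ha hx).deriv, neg_lt_zero]
  exact div_pos (one_div_pos.2 (genWeight_pos ha hx)) hx.1

lemma surjOn_genMu (ha : a ∈ Ioc (0 : ℝ) (1 / 2)) : SurjOn (genMu a) (Ioo 0 1) (Ioi 0) :=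
  isPreconnected_Ioo.intermediate_value_Ioi (l₁ := 𝓝[<] 1) (l₂ := 𝓝[>] 0)
    (le_principal_iff.2 (Ioo_mem_nhdsLT one_pos)) (le_principal_iff.2 (Ioo_mem_nhdsGT one_pos))
    (fun _ hx => (hasDerivAt_genMu ha hx).continuousAt.continuousWithinAt)
    (tendsto_genMu_one ha) (tendsto_genMu_zero ha)

lemma genMuInv_mem (ha : a ∈ Ioc (0 : ℝ) (1 / 2)) {x : ℝ} (hx : 0 < x) :
    genMuInv a x ∈ Ioo (0 : ℝ) 1 := Function.invFunOn_mem (surjOn_genMu ha hx)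

lemma genMu_genMuInv (ha : a ∈ Ioc (0 : ℝ) (1 / 2)) {x : ℝ} (hx : 0 < x) :
    genMu a (genMuInv a x) = x := Function.invFunOn_eq (surjOn_genMu ha hx)

lemma genMuInv_genMu (ha : a ∈ Ioc (0 : ℝ) (1 / 2)) {r : ℝ} (hr : r ∈ Ioo (0 : ℝ) 1) :
    genMuInv a (genMu a r) = r :=
  (genMu_strictAntiOn ha).injOn.leftInvOn_invFunOn hr

lemma genMuInv_strictAntiOn (ha : a ∈ Ioc (0 : ℝ) (1 / 2)) :
    StrictAntiOn (genMuInv a) (Ioi 0) := by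
  intro x hx y hy hxy
  rwa [← (genMu_strictAntiOn ha).lt_iff_gt (genMuInv_mem ha hx) (genMuInv_mem ha hy),
    genMu_genMuInv ha hx, genMu_genMuInv ha hy]

lemma continuousAt_genMuInv (ha : a ∈ Ioc (0 : ℝ) (1 / 2)) {x : ℝ} (hx : 0 < x) :
    ContinuousAt (genMuInv a) x := by
  have hmono : StrictMonoOn (fun y => -genMuInv a y) (Ioi 0) := (genMuInv_strictAntiOn ha).neg
  have himg : Ioo (-1 : ℝ) 0 ⊆ (fun y => -genMuInv a y) '' Ioi 0 := fun y hy => by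
    have hy' : -y ∈ Ioo (0 : ℝ) 1 := ⟨by linarith [hy.2], by linarith [hy.1]⟩
    exact ⟨genMu a (-y), genMu_pos ha hy', by simp [genMuInv_genMu ha hy']⟩
  have hm := genMuInv_mem ha hx
  have h := hmono.continuousAt_of_image_mem_nhds (Ioi_mem_nhds hx)
    (mem_of_superset (Ioo_mem_nhds (by linarith [hm.2]) (by linarith [hm.1])) himg)
  exact h.neg.congr (Eventually.of_forall fun y => neg_neg _)

lemma hasDerivAt_genMuInv (ha : a ∈ Ioc (0 : ℝ) (1 / 2)) {x : ℝ} (hx : 0 < x) :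
    HasDerivAt (genMuInv a) (-(genMuInv a x * genWeight a (genMuInv a x))) x := by
  have hm := genMuInv_mem ha hx
  have hw := (genWeight_pos ha hm).ne'
  have h0 := hm.1.ne'
  have h := HasDerivAt.of_local_left_inverse (continuousAt_genMuInv ha hx)
    (hasDerivAt_genMu ha hm) (neg_ne_zero.2 (div_ne_zero (one_div_ne_zero hw) h0))
    (by filter_upwards [Ioi_mem_nhds hx] with y hy using genMu_genMuInv ha hy)
  refine h.congr_deriv ?_
  field_simp

/-! ### The weight in the coordinate `x = μ_a(r)` -/

/-- The weight as a function of `x = μ_a(r)`, so that `m_a(r) = x * muWeight a x`. -/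
noncomputable def muWeight (a x : ℝ) : ℝ := genWeight a (genMuInv a x)

lemma muWeight_pos (ha : a ∈ Ioc (0 : ℝ) (1 / 2)) {x : ℝ} (hx : 0 < x) : 0 < muWeight a x :=
  genWeight_pos ha (genMuInv_mem ha hx)

lemma muWeight_lt_one (ha : a ∈ Ioc (0 : ℝ) (1 / 2)) {x : ℝ} (hx : 0 < x) : muWeight a x < 1 :=
  genWeight_lt_one ha (genMuInv_mem ha hx)

lemma muWeight_strictMonoOn (ha : a ∈ Ioc (0 : ℝ) (1 / 2)) :
    StrictMonoOn (muWeight a) (Ioi 0) := fun _ hx _ hy hxy =>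
  genWeight_strictAntiOn ha (Ioo_subset_Ico_self (genMuInv_mem ha hy))
    (Ioo_subset_Ico_self (genMuInv_mem ha hx)) (genMuInv_strictAntiOn ha hx hy hxy)

lemma genM_eq_mul_muWeight (ha : a ∈ Ioc (0 : ℝ) (1 / 2)) {r : ℝ} (hr : r ∈ Ioo (0 : ℝ) 1) :
    genM a r = genMu a r * muWeight a (genMu a r) := by
  rw [muWeight, genMuInv_genMu ha hr, genM_eq ha hr]

lemma hasDerivAt_muWeight (ha : a ∈ Ioc (0 : ℝ) (1 / 2)) {x : ℝ} (hx : 0 < x) :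
    HasDerivAt (muWeight a) (muWeight a x * genWeightLogDeriv a (genMuInv a x)) x := by
  have hm := genMuInv_mem ha hx
  refine ((hasDerivAt_genWeight ha hm).comp x (hasDerivAt_genMuInv ha hx)).congr_deriv ?_
  have h0 := hm.1.ne'
  unfold muWeight
  field_simp

lemma tendsto_genMuInv_atTop (ha : a ∈ Ioc (0 : ℝ) (1 / 2)) :
    Tendsto (genMuInv a) atTop (𝓝 0) := by
  refine tendsto_order.2 ⟨fun y hy => ?_, fun y hy => ?_⟩
  · filter_upwards [eventually_gt_atTop 0] with x hx
    exact hy.trans (genMuInv_mem ha hx).1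
  · have hε : min y (1 / 2) ∈ Ioo (0 : ℝ) 1 :=
      ⟨lt_min hy (by norm_num), (min_le_right _ _).trans_lt (by norm_num)⟩
    have hpos := genMu_pos ha hε
    filter_upwards [eventually_gt_atTop (genMu a (min y (1 / 2)))] with x hx
    have := genMuInv_strictAntiOn ha hpos (hpos.trans hx) hx
    rw [genMuInv_genMu ha hε] at this
    exact this.trans_le (min_le_left _ _)

lemma tendsto_muWeight_atTop (ha : a ∈ Ioc (0 : ℝ) (1 / 2)) :
    Tendsto (muWeight a) atTop (𝓝 1) := by
  have h := (continuousAt_genWeight_zero ha).tendsto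
  rw [genWeight_zero] at h
  exact h.comp (tendsto_genMuInv_atTop ha)

/-- For `k ≥ 1` the ratio `muWeight a (k x) / muWeight a x` decreases in `x`, because the
logarithmic derivative `x w'(x) / w(x)` of `w = muWeight a` equals `μ_a V` at the corresponding
point of `(0, 1)`. -/
lemma muWeight_mul_le (ha : a ∈ Ioc (0 : ℝ) (1 / 2)) {k x y : ℝ} (hk : 1 ≤ k) (hx : 0 < x)
    (hxy : x ≤ y) : muWeight a (k * y) * muWeight a x ≤ muWeight a (k * x) * muWeight a y := by
  have hk0 : 0 < k := one_pos.trans_le hk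
  have hd : ∀ x ∈ Ioi (0 : ℝ), HasDerivAt
      (fun x => Real.log (muWeight a (k * x)) - Real.log (muWeight a x))
      (k * genWeightLogDeriv a (genMuInv a (k * x)) - genWeightLogDeriv a (genMuInv a x)) x :=
    fun x hx => by
    have hkx : 0 < k * x := mul_pos hk0 hx
    have hm : HasDerivAt (fun y => k * y) k x := by simpa using (hasDerivAt_id x).const_mul k
    have h1 := ((hasDerivAt_muWeight ha hkx).comp x hm).log (muWeight_pos ha hkx).ne'
    have h2 := (hasDerivAt_muWeight ha hx).log (muWeight_pos ha hx).ne'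
    refine (h1.sub h2).congr_deriv ?_
    have h3 := (muWeight_pos ha hkx).ne'
    have h4 := (muWeight_pos ha hx).ne'
    simp only [Function.comp]
    field_simp
  have hanti : AntitoneOn
      (fun x => Real.log (muWeight a (k * x)) - Real.log (muWeight a x)) (Ioi 0) := by
    refine antitoneOn_of_deriv_nonpos (convex_Ioi 0)
      (fun x hx => (hd x hx).continuousAt.continuousWithinAt)
      (fun x hx => (hd x (interior_subset hx)).differentiableAt.differentiableWithinAt)
      fun x hx => ?_
    replace hx : 0 < x := interior_subset hx
    rw [(hd x hx).deriv]
    have hkx : 0 < k * x := mul_pos hk0 hx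
    have h := (genMu_mul_genWeightLogDeriv_strictMonoOn ha).monotoneOn (genMuInv_mem ha hkx)
      (genMuInv_mem ha hx)
      ((genMuInv_strictAntiOn ha).antitoneOn hx hkx (le_mul_of_one_le_left hx.le hk))
    simp only [genMu_genMuInv ha hx, genMu_genMuInv ha hkx] at h
    refine le_of_mul_le_mul_left ?_ hx
    linarith
  have hy : 0 < y := hx.trans_le hxy
  have h := hanti hx hy hxy
  have p1 := muWeight_pos ha hx
  have p2 := muWeight_pos ha hy
  have p3 := muWeight_pos ha (mul_pos hk0 hx)
  have p4 := muWeight_pos ha (mul_pos hk0 hy)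
  rw [← Real.log_le_log_iff (mul_pos p4 p1) (mul_pos p3 p2), Real.log_mul p4.ne' p1.ne',
    Real.log_mul p3.ne' p2.ne']
  simp only at h
  linarith

/-! ### The logarithmic derivative of the product ratio -/

/-- The combination `x w(k x) + y w(k y) - z w(k z)`, where `w = muWeight a` and `x`, `y`, `z` are
the values of `μ_a` at `r`, `t`, `r t`.  It is minus the derivative in `k` of the logarithm of
`φ_{1/k}(r) φ_{1/k}(t) / φ_{1/k}(r t)`. -/
noncomputable def muWeightDefect (a r t k : ℝ) : ℝ :=
  genMu a r * muWeight a (k * genMu a r) + genMu a t * muWeight a (k * genMu a t) -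
    genMu a (r * t) * muWeight a (k * genMu a (r * t))

variable {r t : ℝ}

lemma mul_mem_Ioo (hr : r ∈ Ioo (0 : ℝ) 1) (ht : t ∈ Ioo (0 : ℝ) 1) : r * t ∈ Ioo (0 : ℝ) 1 :=
  ⟨mul_pos hr.1 ht.1, mul_lt_one_of_nonneg_of_lt_one_left hr.1.le hr.2 ht.2.le⟩

lemma genMu_lt_genMu_mul (ha : a ∈ Ioc (0 : ℝ) (1 / 2)) (hr : r ∈ Ioo (0 : ℝ) 1)
    (ht : t ∈ Ioo (0 : ℝ) 1) : genMu a r < genMu a (r * t) ∧ genMu a t < genMu a (r * t) :=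
  ⟨genMu_strictAntiOn ha (mul_mem_Ioo hr ht) hr (mul_lt_of_lt_one_right hr.1 ht.2),
    genMu_strictAntiOn ha (mul_mem_Ioo hr ht) ht (mul_lt_of_lt_one_left ht.1 hr.2)⟩

lemma muWeightDefect_one (ha : a ∈ Ioc (0 : ℝ) (1 / 2)) (hr : r ∈ Ioo (0 : ℝ) 1)
    (ht : t ∈ Ioo (0 : ℝ) 1) :
    muWeightDefect a r t 1 = genM a r + genM a t - genM a (r * t) := by
  rw [genM_eq_mul_muWeight ha hr, genM_eq_mul_muWeight ha ht,
    genM_eq_mul_muWeight ha (mul_mem_Ioo hr ht), muWeightDefect, one_mul, one_mul, one_mul]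

lemma muWeightDefect_lt (ha : a ∈ Ioc (0 : ℝ) (1 / 2)) (hr : r ∈ Ioo (0 : ℝ) 1)
    (ht : t ∈ Ioo (0 : ℝ) 1) {k : ℝ} (hk : 0 < k) :
    muWeightDefect a r t k < genMu a r + genMu a t - genMu a (r * t) := by
  have hrt := mul_mem_Ioo hr ht
  have hA := genMu_pos ha hr
  have hB := genMu_pos ha ht
  have hC := genMu_pos ha hrt
  obtain ⟨hAC, hBC⟩ := genMu_lt_genMu_mul ha hr ht
  have hABC := genMu_mul_lt ha hr ht
  have hm := muWeight_strictMonoOn ha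
  have h1 := hm (mul_pos hk hA) (mul_pos hk hC) (mul_lt_mul_of_pos_left hAC hk)
  have h2 := hm (mul_pos hk hB) (mul_pos hk hC) (mul_lt_mul_of_pos_left hBC hk)
  have h3 := muWeight_lt_one ha (mul_pos hk hC)
  unfold muWeightDefect
  nlinarith [mul_lt_mul_of_pos_left h1 hA, mul_lt_mul_of_pos_left h2 hB,
    mul_pos (sub_pos.2 hABC) (sub_pos.2 h3)]

lemma tendsto_muWeightDefect (ha : a ∈ Ioc (0 : ℝ) (1 / 2)) (hr : r ∈ Ioo (0 : ℝ) 1)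
    (ht : t ∈ Ioo (0 : ℝ) 1) :
    Tendsto (muWeightDefect a r t) atTop
      (𝓝 (genMu a r + genMu a t - genMu a (r * t))) := by
  have key : ∀ s ∈ Ioo (0 : ℝ) 1,
      Tendsto (fun k => genMu a s * muWeight a (k * genMu a s)) atTop (𝓝 (genMu a s)) :=
    fun s hs => by
    simpa using ((tendsto_muWeight_atTop ha).comp
      (tendsto_id.atTop_mul_const (genMu_pos ha hs))).const_mul (genMu a s)
  exact ((key r hr).add (key t ht)).sub (key _ (mul_mem_Ioo hr ht))

lemma continuousAt_muWeightDefect_one (ha : a ∈ Ioc (0 : ℝ) (1 / 2)) (hr : r ∈ Ioo (0 : ℝ) 1)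
    (ht : t ∈ Ioo (0 : ℝ) 1) : ContinuousAt (muWeightDefect a r t) 1 := by
  have key : ∀ s ∈ Ioo (0 : ℝ) 1,
      ContinuousAt (fun k => genMu a s * muWeight a (k * genMu a s)) 1 := fun s hs => by
    have h : ContinuousAt (muWeight a) (1 * genMu a s) :=
      (hasDerivAt_muWeight ha (mul_pos one_pos (genMu_pos ha hs))).continuousAt
    have hm : ContinuousAt (fun k : ℝ => k * genMu a s) 1 := by fun_prop
    exact (h.comp (f := fun k : ℝ => k * genMu a s) hm).const_mul (genMu a s)
  exact ((key r hr).add (key t ht)).sub (key _ (mul_mem_Ioo hr ht))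

/-- The increments `x (w(k x) - w(x))` are the products of `m_a = x w(x)`, which is strictly
subadditive, and of a positive factor that is smallest at `r t`. -/
lemma muWeightDefect_one_lt (ha : a ∈ Ioc (0 : ℝ) (1 / 2)) (hr : r ∈ Ioo (0 : ℝ) 1)
    (ht : t ∈ Ioo (0 : ℝ) 1) {k : ℝ} (hk : 1 < k) :
    muWeightDefect a r t 1 < muWeightDefect a r t k := by
  have hrt := mul_mem_Ioo hr ht
  have hC := genMu_pos ha hrt
  obtain ⟨hAC, hBC⟩ := genMu_lt_genMu_mul ha hr ht
  have hm := genM_mul_lt ha hr ht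
  have hw := muWeight_pos ha hC
  have hθ : 0 < muWeight a (k * genMu a (r * t)) - muWeight a (genMu a (r * t)) :=
    sub_pos.2 (muWeight_strictMonoOn ha hC (mul_pos (one_pos.trans hk) hC)
      (lt_mul_of_one_lt_left hC hk))
  have key : ∀ s ∈ Ioo (0 : ℝ) 1, genMu a s < genMu a (r * t) →
      genM a s * (muWeight a (k * genMu a (r * t)) - muWeight a (genMu a (r * t))) ≤
      muWeight a (genMu a (r * t)) * (genMu a s * muWeight a (k * genMu a s) - genM a s) :=
    fun s hs hsC => by
    have h := mul_le_mul_of_nonneg_left (muWeight_mul_le ha hk.le (genMu_pos ha hs) hsC.le)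
      (genMu_pos ha hs).le
    rw [genM_eq_mul_muWeight ha hs]
    linarith
  rw [muWeightDefect_one ha hr ht, muWeightDefect]
  refine lt_of_mul_lt_mul_left ?_ hw.le
  have h1 := key r hr hAC
  have h2 := key t ht hBC
  have h3 := mul_lt_mul_of_pos_right hm hθ
  have h4 := genM_eq_mul_muWeight ha hrt
  rw [h4] at h3 ⊢
  linarith

lemma muWeightDefect_lt_one (ha : a ∈ Ioc (0 : ℝ) (1 / 2)) (hr : r ∈ Ioo (0 : ℝ) 1)
    (ht : t ∈ Ioo (0 : ℝ) 1) {k : ℝ} (hk0 : 0 < k) (hk : k < 1) :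
    muWeightDefect a r t k < muWeightDefect a r t 1 := by
  have hrt := mul_mem_Ioo hr ht
  have hC := genMu_pos ha hrt
  obtain ⟨hAC, hBC⟩ := genMu_lt_genMu_mul ha hr ht
  have hm := genM_mul_lt ha hr ht
  have hw := muWeight_pos ha hC
  have hθ : 0 < muWeight a (genMu a (r * t)) - muWeight a (k * genMu a (r * t)) :=
    sub_pos.2 (muWeight_strictMonoOn ha (mul_pos hk0 hC) hC (mul_lt_of_lt_one_left hC hk))
  have key : ∀ s ∈ Ioo (0 : ℝ) 1, genMu a s < genMu a (r * t) →
      genM a s * (muWeight a (genMu a (r * t)) - muWeight a (k * genMu a (r * t))) ≤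
      muWeight a (genMu a (r * t)) * (genM a s - genMu a s * muWeight a (k * genMu a s)) :=
    fun s hs hsC => by
    -- The ratio inequality with factor `k⁻¹ > 1` at the points `k μ_a(s) < k μ_a(r t)`.
    have h := muWeight_mul_le ha (one_lt_inv_iff₀.2 ⟨hk0, hk⟩).le
      (mul_pos hk0 (genMu_pos ha hs)) (mul_le_mul_of_nonneg_left hsC.le hk0.le)
    rw [inv_mul_cancel_left₀ hk0.ne', inv_mul_cancel_left₀ hk0.ne'] at h
    have h' := mul_le_mul_of_nonneg_left h (genMu_pos ha hs).le
    rw [genM_eq_mul_muWeight ha hs]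
    linarith
  rw [muWeightDefect_one ha hr ht, muWeightDefect]
  refine lt_of_mul_lt_mul_left ?_ hw.le
  have h1 := key r hr hAC
  have h2 := key t ht hBC
  have h3 := mul_lt_mul_of_pos_right hm hθ
  have h4 := genM_eq_mul_muWeight ha hrt
  rw [h4] at h3 ⊢
  linarith

/-! ### Monotonicity criteria -/

section Criteria

variable {G H : ℝ → ℝ} {l M : ℝ} {S : Set ℝ}

lemma nonneg_of_strictMonoOn {U : Set ℝ} (hU : IsOpen U) (hG : StrictMonoOn G U) {k d : ℝ}
    (hk : k ∈ U) (hd : HasDerivAt G d k) : 0 ≤ d := by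
  have := hG.monotoneOn.derivWithin_nonneg (x := k)
  rwa [derivWithin_of_isOpen hU hk, hd.deriv] at this

lemma nonpos_of_strictAntiOn {U : Set ℝ} (hU : IsOpen U) (hG : StrictAntiOn G U) {k d : ℝ}
    (hk : k ∈ U) (hd : HasDerivAt G d k) : d ≤ 0 := by
  have := nonneg_of_strictMonoOn hU hG.neg hk hd.neg
  linarith

lemma strictMonoOn_iff_of_tendsto (hS1 : Ioi 1 ⊆ S) (hS2 : S ⊆ Ici 1)
    (hG : ∀ k > 0, HasDerivAt G (l - H k) k) (hH : ∀ k > 0, H k < M)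
    (hlim : Tendsto H atTop (𝓝 M)) : StrictMonoOn G S ↔ M ≤ l := by
  constructor
  · intro h
    refine le_of_tendsto hlim ?_
    filter_upwards [eventually_gt_atTop 1] with k hk
    have := nonneg_of_strictMonoOn isOpen_Ioi (h.mono hS1) hk (hG k (one_pos.trans hk))
    linarith
  · intro h
    refine StrictMonoOn.mono ?_ hS2
    refine strictMonoOn_of_deriv_pos (convex_Ici 1) (fun k hk =>
      (hG k (one_pos.trans_le hk)).continuousAt.continuousWithinAt) fun k hk => ?_
    rw [interior_Ici] at hk
    have hk0 : 0 < k := one_pos.trans hk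
    rw [(hG k hk0).deriv]
    linarith [hH k hk0]

lemma strictAntiOn_iff_of_continuousAt (hS1 : Ioi 1 ⊆ S) (hS2 : S ⊆ Ici 1)
    (hG : ∀ k > 0, HasDerivAt G (l - H k) k) (hH : ∀ k > 1, H 1 < H k)
    (hc : ContinuousAt H 1) : StrictAntiOn G S ↔ l ≤ H 1 := by
  constructor
  · intro h
    refine ge_of_tendsto (hc.tendsto.mono_left (nhdsWithin_le_nhds (s := Ioi 1))) ?_
    filter_upwards [self_mem_nhdsWithin] with k hk
    have := nonpos_of_strictAntiOn isOpen_Ioi (h.mono hS1) hk (hG k (one_pos.trans hk))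
    linarith
  · intro h
    refine StrictAntiOn.mono ?_ hS2
    refine strictAntiOn_of_deriv_neg (convex_Ici 1) (fun k hk =>
      (hG k (one_pos.trans_le hk)).continuousAt.continuousWithinAt) fun k hk => ?_
    rw [interior_Ici] at hk
    rw [(hG k (one_pos.trans hk)).deriv]
    linarith [hH k hk]

lemma strictMonoOn_iff_of_continuousAt (hS1 : Ioo 0 1 ⊆ S) (hS2 : S ⊆ Ioc 0 1)
    (hG : ∀ k > 0, HasDerivAt G (l - H k) k) (hH : ∀ k > 0, k < 1 → H k < H 1)
    (hc : ContinuousAt H 1) : StrictMonoOn G S ↔ H 1 ≤ l := by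
  constructor
  · intro h
    refine le_of_tendsto (hc.tendsto.mono_left (nhdsWithin_le_nhds (s := Iio 1))) ?_
    filter_upwards [Ioo_mem_nhdsLT (one_pos : (0 : ℝ) < 1)] with k hk
    have := nonneg_of_strictMonoOn isOpen_Ioo (h.mono hS1) hk (hG k hk.1)
    linarith
  · intro h
    refine StrictMonoOn.mono ?_ hS2
    refine strictMonoOn_of_deriv_pos (convex_Ioc 0 1) (fun k hk =>
      (hG k hk.1).continuousAt.continuousWithinAt) fun k hk => ?_
    rw [interior_Ioc] at hk
    rw [(hG k hk.1).deriv]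
    linarith [hH k hk.1 hk.2]

lemma inv_mem_Ici_of_mem_Ioc {x : ℝ} (hx : x ∈ Ioc (0 : ℝ) 1) : x⁻¹ ∈ Ici (1 : ℝ) :=
  (one_le_inv₀ hx.1).2 hx.2

lemma inv_mem_Ioc_of_mem_Ici {x : ℝ} (hx : x ∈ Ici (1 : ℝ)) : x⁻¹ ∈ Ioc (0 : ℝ) 1 :=
  ⟨inv_pos.2 (one_pos.trans_le hx), inv_le_one_of_one_le₀ hx⟩

lemma inv_mem_Ioi_of_mem_Ioo {x : ℝ} (hx : x ∈ Ioo (0 : ℝ) 1) : x⁻¹ ∈ Ioi (1 : ℝ) :=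
  (one_lt_inv₀ hx.1).2 hx.2

lemma inv_mem_Ioo_of_mem_Ioi {x : ℝ} (hx : x ∈ Ioi (1 : ℝ)) : x⁻¹ ∈ Ioo (0 : ℝ) 1 :=
  ⟨inv_pos.2 (one_pos.trans hx), inv_lt_one_of_one_lt₀ hx⟩

lemma strictMonoOn_comp_inv_iff {T : Set ℝ} (hS : S ⊆ Ioi 0) (hT : T ⊆ Ioi 0)
    (hST : MapsTo (·⁻¹) S T) (hTS : MapsTo (·⁻¹) T S) :
    StrictMonoOn (fun k => G k⁻¹) S ↔ StrictAntiOn G T := by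
  constructor
  · intro h x hx y hy hxy
    simpa using h (hTS hy) (hTS hx) ((inv_lt_inv₀ (hT hy) (hT hx)).2 hxy)
  · intro h x hx y hy hxy
    exact h (hST hy) (hST hx) ((inv_lt_inv₀ (hS hy) (hS hx)).2 hxy)

lemma strictAntiOn_comp_inv_iff {T : Set ℝ} (hS : S ⊆ Ioi 0) (hT : T ⊆ Ioi 0)
    (hST : MapsTo (·⁻¹) S T) (hTS : MapsTo (·⁻¹) T S) :
    StrictAntiOn (fun k => G k⁻¹) S ↔ StrictMonoOn G T := by
  constructor
  · intro h x hx y hy hxy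
    simpa using h (hTS hy) (hTS hx) ((inv_lt_inv₀ (hT hy) (hT hx)).2 hxy)
  · intro h x hx y hy hxy
    exact h (hST hy) (hST hx) ((inv_lt_inv₀ (hS hy) (hS hx)).2 hxy)

end Criteria

/-- The logarithm of `g₂`. -/
noncomputable def logProductRatio (l a r t k : ℝ) : ℝ :=
  Real.log (genMuInv a (k * genMu a r)) + Real.log (genMuInv a (k * genMu a t)) -
    Real.log (genMuInv a (k * genMu a (r * t))) + l * k

lemma hasDerivAt_logProductRatio (ha : a ∈ Ioc (0 : ℝ) (1 / 2)) (hr : r ∈ Ioo (0 : ℝ) 1)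
    (ht : t ∈ Ioo (0 : ℝ) 1) (l : ℝ) {k : ℝ} (hk : 0 < k) :
    HasDerivAt (logProductRatio l a r t) (l - muWeightDefect a r t k) k := by
  have key : ∀ s ∈ Ioo (0 : ℝ) 1, HasDerivAt (fun k => Real.log (genMuInv a (k * genMu a s)))
      (-(genMu a s * muWeight a (k * genMu a s))) k := fun s hs => by
    have hx : 0 < k * genMu a s := mul_pos hk (genMu_pos ha hs)
    have hm : HasDerivAt (fun k => k * genMu a s) (genMu a s) k := by
      simpa using (hasDerivAt_id k).mul_const (genMu a s)
    have h0 := (genMuInv_mem ha hx).1.ne'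
    have hc : HasDerivAt (fun k => genMuInv a (k * genMu a s)) _ k :=
      (hasDerivAt_genMuInv ha hx).comp k hm
    refine (hc.log h0).congr_deriv ?_
    unfold muWeight
    field_simp
  have hl : HasDerivAt (fun k => l * k) l k := by simpa using (hasDerivAt_id k).const_mul l
  refine ((((key r hr).add (key t ht)).sub (key _ (mul_mem_Ioo hr ht))).add hl).congr_deriv ?_
  unfold muWeightDefect
  ring

lemma g₂_eq_exp (ha : a ∈ Ioc (0 : ℝ) (1 / 2)) (hr : r ∈ Ioo (0 : ℝ) 1)
    (ht : t ∈ Ioo (0 : ℝ) 1) (l : ℝ) {k : ℝ} (hk : 0 < k) :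
    g₂ l a r t k = Real.exp (logProductRatio l a r t k) := by
  have key : ∀ s ∈ Ioo (0 : ℝ) 1, genPhi a (1 / k) s =
      Real.exp (Real.log (genMuInv a (k * genMu a s))) := fun s hs => by
    rw [Real.exp_log (genMuInv_mem ha (mul_pos hk (genMu_pos ha hs))).1, genPhi_eq,
      div_div_eq_mul_div, div_one, mul_comm]
  rw [g₂, key r hr, key t ht, key _ (mul_mem_Ioo hr ht), logProductRatio, Real.exp_add,
    Real.exp_sub, Real.exp_add, ← Real.exp_mul]
  ring

lemma g₁_eq_g₂_inv (l a r t K : ℝ) : g₁ l a r t K = g₂ l a r t K⁻¹ := by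
  simp [g₁, g₂]

lemma strictMonoOn_g₂_iff_log (ha : a ∈ Ioc (0 : ℝ) (1 / 2)) (hr : r ∈ Ioo (0 : ℝ) 1)
    (ht : t ∈ Ioo (0 : ℝ) 1) (l : ℝ) {S : Set ℝ} (hS : S ⊆ Ioi 0) :
    StrictMonoOn (g₂ l a r t) S ↔ StrictMonoOn (logProductRatio l a r t) S := by
  refine forall₂_congr fun x hx => forall₂_congr fun y hy => ?_
  rw [g₂_eq_exp ha hr ht l (hS hx), g₂_eq_exp ha hr ht l (hS hy), Real.exp_lt_exp]

lemma strictAntiOn_g₂_iff_log (ha : a ∈ Ioc (0 : ℝ) (1 / 2)) (hr : r ∈ Ioo (0 : ℝ) 1)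
    (ht : t ∈ Ioo (0 : ℝ) 1) (l : ℝ) {S : Set ℝ} (hS : S ⊆ Ioi 0) :
    StrictAntiOn (g₂ l a r t) S ↔ StrictAntiOn (logProductRatio l a r t) S := by
  refine forall₂_congr fun x hx => forall₂_congr fun y hy => ?_
  rw [g₂_eq_exp ha hr ht l (hS hx), g₂_eq_exp ha hr ht l (hS hy), Real.exp_lt_exp]

lemma strictMonoOn_g₂_iff_genMu (ha : a ∈ Ioc (0 : ℝ) (1 / 2)) (hr : r ∈ Ioo (0 : ℝ) 1)
    (ht : t ∈ Ioo (0 : ℝ) 1) (l : ℝ) {S : Set ℝ} (hS1 : Ioi 1 ⊆ S) (hS2 : S ⊆ Ici 1) :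
    StrictMonoOn (g₂ l a r t) S ↔ genMu a r + genMu a t - genMu a (r * t) ≤ l := by
  rw [strictMonoOn_g₂_iff_log ha hr ht l (hS2.trans (Ici_subset_Ioi.2 one_pos))]
  exact strictMonoOn_iff_of_tendsto hS1 hS2
    (fun k hk => hasDerivAt_logProductRatio ha hr ht l hk)
    (fun k hk => muWeightDefect_lt ha hr ht hk) (tendsto_muWeightDefect ha hr ht)

lemma strictAntiOn_g₂_iff_genM (ha : a ∈ Ioc (0 : ℝ) (1 / 2)) (hr : r ∈ Ioo (0 : ℝ) 1)
    (ht : t ∈ Ioo (0 : ℝ) 1) (l : ℝ) {S : Set ℝ} (hS1 : Ioi 1 ⊆ S) (hS2 : S ⊆ Ici 1) :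
    StrictAntiOn (g₂ l a r t) S ↔ l ≤ genM a r + genM a t - genM a (r * t) := by
  rw [strictAntiOn_g₂_iff_log ha hr ht l (hS2.trans (Ici_subset_Ioi.2 one_pos)),
    ← muWeightDefect_one ha hr ht]
  exact strictAntiOn_iff_of_continuousAt hS1 hS2
    (fun k hk => hasDerivAt_logProductRatio ha hr ht l hk)
    (fun k hk => muWeightDefect_one_lt ha hr ht hk) (continuousAt_muWeightDefect_one ha hr ht)

lemma strictMonoOn_g₂_iff_genM (ha : a ∈ Ioc (0 : ℝ) (1 / 2)) (hr : r ∈ Ioo (0 : ℝ) 1)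
    (ht : t ∈ Ioo (0 : ℝ) 1) (l : ℝ) {S : Set ℝ} (hS1 : Ioo 0 1 ⊆ S) (hS2 : S ⊆ Ioc 0 1) :
    StrictMonoOn (g₂ l a r t) S ↔ genM a r + genM a t - genM a (r * t) ≤ l := by
  rw [strictMonoOn_g₂_iff_log ha hr ht l (hS2.trans fun _ hx => hx.1),
    ← muWeightDefect_one ha hr ht]
  exact strictMonoOn_iff_of_continuousAt hS1 hS2
    (fun k hk => hasDerivAt_logProductRatio ha hr ht l hk)
    (fun k hk hk1 => muWeightDefect_lt_one ha hr ht hk hk1)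
    (continuousAt_muWeightDefect_one ha hr ht)

end

theorem theorem5
    (lam tau : ℝ → ℝ → ℝ → ℝ)
    (a r t : ℝ) (ha : a ∈ Set.Ioc (0 : ℝ) (1 / 2))
    (hr : r ∈ Set.Ioo (0 : ℝ) 1) (ht : t ∈ Set.Ioo (0 : ℝ) 1) :
    ((StrictMonoOn (g₁ (lam a r t) a r t) (Set.Ioc 0 1) ↔
        lam a r t ≤ genM a r + genM a t - genM a (r * t)) ∧
      (StrictAntiOn (g₁ (lam a r t) a r t) (Set.Ioc 0 1) ↔
        lam a r t ≥ genMu a r + genMu a t - genMu a (r * t)) ∧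
      (StrictAntiOn (g₁ (lam a r t) a r t) (Set.Ioi 1) ↔
        lam a r t ≥ genM a r + genM a t - genM a (r * t))) ∧
    ((StrictMonoOn (g₂ (tau a r t) a r t) (Set.Ioc 0 1) ↔
        tau a r t ≥ genM a r + genM a t - genM a (r * t)) ∧
      (StrictMonoOn (g₂ (tau a r t) a r t) (Set.Ioi 1) ↔
        tau a r t ≥ genMu a r + genMu a t - genMu a (r * t)) ∧
      (StrictAntiOn (g₂ (tau a r t) a r t) (Set.Ioi 1) ↔
        tau a r t ≤ genM a r + genM a t - genM a (r * t))) := by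
  have hg : g₁ (lam a r t) a r t = fun K => g₂ (lam a r t) a r t K⁻¹ :=
    funext fun K => g₁_eq_g₂_inv _ a r t K
  have hIoc : Ioc (0 : ℝ) 1 ⊆ Ioi 0 := fun _ hx => hx.1
  have hIoo : Ioo (0 : ℝ) 1 ⊆ Ioi 0 := fun _ hx => hx.1
  have hIci : Ici (1 : ℝ) ⊆ Ioi 0 := Ici_subset_Ioi.2 one_pos
  have hIoi : Ioi (1 : ℝ) ⊆ Ioi 0 := Ioi_subset_Ioi zero_le_one
  refine ⟨⟨?_, ?_, ?_⟩, ?_, ?_, ?_⟩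
  · rw [hg, strictMonoOn_comp_inv_iff hIoc hIci (fun _ => inv_mem_Ici_of_mem_Ioc)
      (fun _ => inv_mem_Ioc_of_mem_Ici)]
    exact strictAntiOn_g₂_iff_genM ha hr ht _ Ioi_subset_Ici_self subset_rfl
  · rw [hg, strictAntiOn_comp_inv_iff hIoc hIci (fun _ => inv_mem_Ici_of_mem_Ioc)
      (fun _ => inv_mem_Ioc_of_mem_Ici)]
    exact strictMonoOn_g₂_iff_genMu ha hr ht _ Ioi_subset_Ici_self subset_rfl
  · rw [hg, strictAntiOn_comp_inv_iff hIoi hIoo (fun _ => inv_mem_Ioo_of_mem_Ioi)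
      (fun _ => inv_mem_Ioi_of_mem_Ioo)]
    exact strictMonoOn_g₂_iff_genM ha hr ht _ subset_rfl Ioo_subset_Ioc_self
  · exact strictMonoOn_g₂_iff_genM ha hr ht _ Ioo_subset_Ioc_self subset_rfl
  · exact strictMonoOn_g₂_iff_genMu ha hr ht _ subset_rfl Ioi_subset_Ici_self
  · exact strictAntiOn_g₂_iff_genM ha hr ht _ subset_rfl Ioi_subset_Ici_self
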